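/- **Notation.** Let $(\Phi_e^X)_{e\in\mathbb N}$ be the standard list of all partial functions computable with oracle $X\subseteq\mathbb N$. Write $W_e^X$ for the domain of $\Phi_e^X$, $J^X(e)=\Phi_e^X(e)$, and $X'=\{e : J^X(e)\text{ is defined}\}$. For $A,B\subseteq\mathbb N$, $A\le_{tt}B$ means that from $n$ one can compute a finite list of queries and a truth table on the possible answer vectors such that $n\in A$ if and only if the table accepts the vector of correct answers to the queries about membership in $B$. A set $B$ is *superhigh* if $\emptyset''\le_{tt}B'$. For $g:\mathbb N\to\mathbb N$, *$X$ is jump traceable by $Y$ with bound $g$* if there is a computable $f$ such that for all $n$: if $J^X(n)$ is defined then $J^X(n)\in W^Y_{f(n)}$; and $W^Y_{f(n)}$ is finite with at most $g(n)$ elements. *$X$ is jump traceable by $Y$* if this holds for some computable $g$; *$X$ is jump traceable* if it is jump traceable by $\emptyset$; *$A$ is JT-hard* if $\emptyset'$ is jump traceable by $A$. $\mathrm{BLR}(A)$ is the class of functions $f:\mathbb N\to\mathbb N$ for which there are an $A$-computable $\tilde f:\mathbb N\times\mathbb N\to\mathbb N$ and a computable $g$ such that for all $n$, $\lim_s\tilde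 f(n,s)=f(n)$ and $\{s:\tilde f(n,s)\ne\tilde f(n,s+1)\}$ has fewer than $g(n)$ elements. $A$ is *BLR-hard* if $\mathrm{BLR}(\emptyset')\subseteq\mathrm{BLR}(A)$. **Theorem.** There is a set $B\subseteq\mathbb N$ that is both superhigh and jump traceable; moreover, $B$ can be chosen to be jump traceable by $\emptyset$ with bound $e\mapsto 4^e$, and to be neither JT-hard nor BLR-hard. In particular, superhighness implies neither JT-hardness nor BLR-hardness. More generally, for every set $A\subseteq\mathbb N$ there is a set $B\subseteq\mathbb N$ with $A\le_{tt}B'$ that is jump traceable by $\emptyset$ with bound $e\mapsto 4^e$. -/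

import Mathlib

namespace Superhighness

/-- Programs for oracle computation: the codes for partial recursive functions, extended by an
instruction `oracle` that queries the oracle. The clauses match those of `Nat.RecursiveIn`. -/
inductive OCode : Type
  | zero : OCode
  | succ : OCode
  | left : OCode
  | right : OCode
  | oracle : OCode
  | pair : OCode → OCode → OCode
  | comp : OCode → OCode → OCode
  | prec : OCode → OCode → OCode
  | rfind : OCode → OCode

namespace OCode

/-- The partial function computed by a program with (possibly partial) oracle `O`. -/
def eval (O : ℕ →. ℕ) : OCode → ℕ →. ℕ
  | zero => fun _ => Part.some 0
  | succ => fun n => Part.some (n + 1)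
  | left => fun n => Part.some (Nat.unpair n).1
  | right => fun n => Part.some (Nat.unpair n).2
  | oracle => O
  | pair cf cg => fun n => Nat.pair <$> eval O cf n <*> eval O cg n
  | comp cf cg => fun n => eval O cg n >>= eval O cf
  | prec cf cg => Nat.unpaired fun a n =>
      n.rec (eval O cf a) fun y IH => do
        let i ← IH
        eval O cg (Nat.pair a (Nat.pair y i))
  | rfind cf => fun a =>
      Nat.rfind fun n => (fun m => decide (m = 0)) <$> eval O cf (Nat.pair a n)

/-- The number of a program. -/
def encode : OCode → ℕ
  | zero => 0
  | succ => 1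
  | left => 2
  | right => 3
  | oracle => 4
  | pair cf cg => 4 * Nat.pair (encode cf) (encode cg) + 5
  | comp cf cg => 4 * Nat.pair (encode cf) (encode cg) + 6
  | prec cf cg => 4 * Nat.pair (encode cf) (encode cg) + 7
  | rfind cf => 4 * encode cf + 8

/-- The program with a given number. -/
def ofNat : ℕ → OCode
  | 0 => zero
  | 1 => succ
  | 2 => left
  | 3 => right
  | 4 => oracle
  | n + 5 =>
    have h : n / 4 < n + 5 := by omega
    have h1 : (n / 4).unpair.1 < n + 5 := lt_of_le_of_lt (Nat.unpair_left_le _) h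
    have h2 : (n / 4).unpair.2 < n + 5 := lt_of_le_of_lt (Nat.unpair_right_le _) h
    match n % 4 with
    | 0 => pair (ofNat (n / 4).unpair.1) (ofNat (n / 4).unpair.2)
    | 1 => comp (ofNat (n / 4).unpair.1) (ofNat (n / 4).unpair.2)
    | 2 => prec (ofNat (n / 4).unpair.1) (ofNat (n / 4).unpair.2)
    | _ => rfind (ofNat (n / 4))

/-- Every program occurs in the list `ofNat 0, ofNat 1, …`. -/
theorem ofNat_encode (c : OCode) : ofNat (encode c) = c := by
  induction c with
  | zero | succ | left | right | oracle => simp [encode, ofNat]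
  | pair cf cg ihf ihg =>
    have h1 : (4 * Nat.pair cf.encode cg.encode) / 4 = Nat.pair cf.encode cg.encode := by omega
    have h2 : (4 * Nat.pair cf.encode cg.encode) % 4 = 0 := by omega
    rw [encode, ofNat, h1, h2]; simp [ihf, ihg]
  | comp cf cg ihf ihg =>
    have h1 : (4 * Nat.pair cf.encode cg.encode + 1) / 4 = Nat.pair cf.encode cg.encode := by
      omega
    have h2 : (4 * Nat.pair cf.encode cg.encode + 1) % 4 = 1 := by omega
    rw [encode, ofNat, h1, h2]; simp [ihf, ihg]
  | prec cf cg ihf ihg =>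
    have h1 : (4 * Nat.pair cf.encode cg.encode + 2) / 4 = Nat.pair cf.encode cg.encode := by
      omega
    have h2 : (4 * Nat.pair cf.encode cg.encode + 2) % 4 = 2 := by omega
    rw [encode, ofNat, h1, h2]; simp [ihf, ihg]
  | rfind cf ihf =>
    have h1 : (4 * cf.encode + 3) / 4 = cf.encode := by omega
    have h2 : (4 * cf.encode + 3) % 4 = 3 := by omega
    rw [encode, ofNat, h1, h2]; simp [ihf]

/-- The programs with oracle `O` compute exactly the partial functions recursive in `O`. -/
theorem recursiveIn_iff {O f : ℕ →. ℕ} : Nat.RecursiveIn {O} f ↔ ∃ c : OCode, eval O c = f := by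
  constructor
  · intro h
    induction h with
    | zero => exact ⟨zero, rfl⟩
    | succ => exact ⟨succ, rfl⟩
    | left => exact ⟨left, rfl⟩
    | right => exact ⟨right, rfl⟩
    | oracle g hg => exact ⟨oracle, (Set.mem_singleton_iff.1 hg).symm⟩
    | pair _ _ ihf ihg =>
      obtain ⟨cf, rfl⟩ := ihf; obtain ⟨cg, rfl⟩ := ihg; exact ⟨pair cf cg, rfl⟩
    | comp _ _ ihf ihg =>
      obtain ⟨cf, rfl⟩ := ihf; obtain ⟨cg, rfl⟩ := ihg; exact ⟨comp cf cg, rfl⟩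
    | prec _ _ ihf ihg =>
      obtain ⟨cf, rfl⟩ := ihf; obtain ⟨cg, rfl⟩ := ihg; exact ⟨prec cf cg, rfl⟩
    | rfind _ ihf => obtain ⟨cf, rfl⟩ := ihf; exact ⟨rfind cf, rfl⟩
  · rintro ⟨c, rfl⟩
    induction c with
    | zero => exact .zero
    | succ => exact .succ
    | left => exact .left
    | right => exact .right
    | oracle => exact .oracle _ rfl
    | pair _ _ ihf ihg => exact .pair ihf ihg
    | comp _ _ ihf ihg => exact .comp ihf ihg
    | prec _ _ ihf ihg => exact .prec ihf ihg
    | rfind _ ihf => exact .rfind ihf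

end OCode

open Classical in
/-- The characteristic function of a set of natural numbers, as an oracle. -/
noncomputable def chi (X : Set ℕ) : ℕ →. ℕ := fun n => Part.some (if n ∈ X then 1 else 0)

/-- `Phi e X` is the `e`-th partial function computable in `X`. -/
noncomputable def Phi (e : ℕ) (X : Set ℕ) : ℕ →. ℕ := (OCode.ofNat e).eval (chi X)

/-- `W e X` is the domain of `Phi e X`. -/
def W (e : ℕ) (X : Set ℕ) : Set ℕ := {n | (Phi e X n).Dom}

/-- The jump function `J^X(n) = Φ_n^X(n)`. -/
noncomputable def J (X : Set ℕ) : ℕ →. ℕ := fun n => Phi n X n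

/-- The jump `X'`, the halting problem relative to `X`. -/
def jump (X : Set ℕ) : Set ℕ := {e | (J X e).Dom}

open Classical in
/-- Truth-table reducibility `A ≤_tt B`: from `n` one can compute a finite list `q n` of queries
and a truth table on the vectors of answers (`t n`, a total Boolean function) such that `n ∈ A`
holds iff the table accepts the vector of correct answers of `B` to the queries. -/
def TTReducible (A B : Set ℕ) : Prop :=
  ∃ (q : ℕ → List ℕ) (t : ℕ → List Bool → Bool), Computable q ∧ Computable₂ t ∧
    ∀ n, n ∈ A ↔ t n ((q n).map fun m => decide (m ∈ B)) = true

/-- `X` is superhigh: `∅'' ≤_tt X'`. -/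
def Superhigh (X : Set ℕ) : Prop := TTReducible (jump (jump ∅)) (jump X)

/-- `J^X` has a trace, uniformly c.e. in `Y`, whose `n`-th member has at most `g n` elements. -/
def JumpTraceableByWithBound (X Y : Set ℕ) (g : ℕ → ℕ) : Prop :=
  ∃ f : ℕ → ℕ, Computable f ∧
    ∀ n, (∀ y ∈ J X n, y ∈ W (f n) Y) ∧ (W (f n) Y).Finite ∧ (W (f n) Y).ncard ≤ g n

/-- `X ≤_JT Y`: `X` is jump traceable by `Y`. -/
def JumpTraceableBy (X Y : Set ℕ) : Prop :=
  ∃ g : ℕ → ℕ, Computable g ∧ JumpTraceableByWithBound X Y g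

/-- `X` is jump traceable: the trace is uniformly c.e. without an oracle. -/
def JumpTraceable (X : Set ℕ) : Prop := JumpTraceableBy X ∅

/-- `A` is JT-hard: `∅'` is jump traceable by `A`. -/
def JTHard (A : Set ℕ) : Prop := JumpTraceableBy (jump ∅) A

/-- `BLR A` is the class of functions boundedly limit computable by `A`: limits of `A`-computable
approximations with a computably bounded number of changes. -/
def BLR (A : Set ℕ) : Set (ℕ → ℕ) :=
  {f | ∃ F : ℕ → ℕ → ℕ, ComputableIn₂ {chi A} F ∧
    (∀ n, ∃ s₀, ∀ s ≥ s₀, F n s = f n) ∧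
    ∃ g : ℕ → ℕ, Computable g ∧
      ∀ n, {s | F n s ≠ F n (s + 1)}.Finite ∧ {s | F n s ≠ F n (s + 1)}.ncard < g n}

/-- `A` is BLR-hard: `BLR(∅') ⊆ BLR(A)`. -/
def BLRHard (A : Set ℕ) : Prop := BLR (jump ∅) ⊆ BLR A

end Superhighness

/-!
The set `B` is a path through a tree of jump traceable sets, and the path spells out `A`.

The nodes of the tree are binary strings. From a node `b` of level `n` one first passes to the first
extension of `b` found along which the `n`-th program halts at `n` (`haltExt`), if there is one, and
then appends the bit `n` of `A`. Whether such an extension exists is not decidable, so a node is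
presented by a word of `n` base `4` digits, each made of a guess at the answer and of a bit of `A`
(`node`). This is a partial computable function of the word: a wrong positive guess makes it
diverge. The use principle shows that if the jump function of `B` is defined at `n` then an
extension existed and was chosen, so the value was already computed along one of the `4 ^ n` words
of length `n`; these values form the trace (`jumpTraceable_pathSet`).

To recover `A` from `B'`, ask for every word of length `n + 1` whether its node is defined and an
initial segment of `B`. Many words may pass, since a wrong negative guess need not be refuted by
`B`, but the correct word is the numerically largest one (`le_path_fst`), and its last digit
carries the bit `n` of `A`. Hence `A ≤_tt B'` (`ttReducible_jump_pathSet`). For `A = ∅''` the set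
`B` is superhigh.

A jump traceable set `B` is not JT-hard (`not_JTHard_of_jumpTraceable`): if `W (f n) B` has at most
`g n` elements, then a list of them is the value of a `B`-partial computable function at `n` and
the exact number of elements, so that tracing this function for each of the possible numbers would
turn a trace of `J^{∅'}` that is c.e. in `B` into a c.e. one. But `∅'` computes the least
element outside of the `n`-th member of a c.e. trace, and some index of this function is a
point at which `J^{∅'}` escapes the trace (`exists_J_jump_notMem`). Finally BLR-hardness implies
JT-hardness (`JTHard_of_BLRHard`).

Oracle computations are handled through strings: replacing the oracle instruction by a table lookup
turns an oracle program and a string into an oracle-free program (`OCode.toCode`), and running these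
for bounded time gives a primitive recursive, monotone approximation `strEval` to `Phi`.
-/

namespace Superhighness

open Nat.Partrec (Code)
open Filter Encodable

/-! ### Continuity of oracle computations -/

namespace OCode

theorem mem_eval_pair {O : ℕ →. ℕ} {cf cg : OCode} {n v : ℕ} :
    v ∈ eval O (pair cf cg) n ↔
      ∃ a ∈ eval O cf n, ∃ b ∈ eval O cg n, Nat.pair a b = v := by
  simp [eval, Seq.seq]

theorem mem_eval_comp {O : ℕ →. ℕ} {cf cg : OCode} {n v : ℕ} :
    v ∈ eval O (comp cf cg) n ↔ ∃ a ∈ eval O cg n, v ∈ eval O cf a := by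
  exact Part.mem_bind_iff

theorem mem_eval_rfind {O : ℕ →. ℕ} {cf : OCode} {n v : ℕ} :
    v ∈ eval O (rfind cf) n ↔
      0 ∈ eval O cf (Nat.pair n v) ∧ ∀ m < v, ∃ a ∈ eval O cf (Nat.pair n m), a ≠ 0 := by
  refine Nat.mem_rfind.trans ?_
  simp

/-- Continuity of `eval` in the oracle. A constant family gives monotonicity; the initial segments
of a set give the use principle. -/
theorem eventually_mem_eval {O : ℕ →. ℕ} {P : ℕ → ℕ →. ℕ}
    (h : ∀ n v, v ∈ O n → ∀ᶠ k in atTop, v ∈ P k n) (c : OCode) :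
    ∀ n v, v ∈ eval O c n → ∀ᶠ k in atTop, v ∈ eval (P k) c n := by
  induction c with
  | zero | succ | left | right => intro n v hv; exact Eventually.of_forall fun _ => hv
  | oracle => exact h
  | pair cf cg ihf ihg =>
    intro n v hv
    obtain ⟨a, ha, b, hb, rfl⟩ := mem_eval_pair.1 hv
    filter_upwards [ihf _ _ ha, ihg _ _ hb] with k h1 h2
    exact mem_eval_pair.2 ⟨a, h1, b, h2, rfl⟩
  | comp cf cg ihf ihg =>
    intro n v hv
    obtain ⟨a, ha, hb⟩ := mem_eval_comp.1 hv
    filter_upwards [ihg _ _ ha, ihf _ _ hb] with k h1 h2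
    exact mem_eval_comp.2 ⟨a, h1, h2⟩
  | prec cf cg ihf ihg =>
    intro n
    simp only [eval, Nat.unpaired]
    generalize n.unpair.1 = a
    induction n.unpair.2 with
    | zero => exact ihf a
    | succ m ih =>
      intro v hv
      obtain ⟨i, hi, hv⟩ := Part.mem_bind_iff.1 hv
      filter_upwards [ih _ hi, ihg _ _ hv] with k h1 h2
      exact Part.mem_bind_iff.2 ⟨i, h1, h2⟩
  | rfind cf ihf =>
    intro n v hv
    obtain ⟨h0, h1⟩ := mem_eval_rfind.1 hv
    have h2 : ∀ᶠ k in atTop, ∀ m ∈ Set.Iio v,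
        ∃ a ∈ eval (P k) cf (Nat.pair n m), a ≠ 0 := by
      refine (Set.finite_Iio v).eventually_all.2 fun m hm => ?_
      obtain ⟨a, ha, ha0⟩ := h1 m hm
      filter_upwards [ihf _ _ ha] with k hk
      exact ⟨a, hk, ha0⟩
    filter_upwards [ihf _ _ h0, h2] with k h3 h4
    exact mem_eval_rfind.2 ⟨h3, h4⟩

theorem eval_mono {O P : ℕ →. ℕ} (h : ∀ n v, v ∈ O n → v ∈ P n) {c : OCode} {n v : ℕ}
    (hv : v ∈ eval O c n) : v ∈ eval P c n :=
  eventually_const.1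
    (eventually_mem_eval (P := fun _ => P) (fun n v hv => Eventually.of_forall fun _ => h n v hv)
      c n v hv)

end OCode

/-! ### Finite strings as oracles -/

/-- A finite binary string as a partial oracle: it answers `0` or `1` to the queries below its
length and is undefined elsewhere. -/
def strOracle (σ : List Bool) : ℕ →. ℕ := fun n => ((σ[n]?).map Bool.toNat : Option ℕ)

open Classical in
/-- The string of the first `k` values of the characteristic function of `X`. -/
noncomputable def initSeg (X : Set ℕ) (k : ℕ) : List Bool :=
  (List.range k).map fun n => decide (n ∈ X)

@[simp] theorem length_initSeg (X : Set ℕ) (k : ℕ) : (initSeg X k).length = k := by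
  simp [initSeg]

open Classical in
theorem initSeg_succ (X : Set ℕ) (k : ℕ) : initSeg X (k + 1) = initSeg X k ++ [decide (k ∈ X)] := by
  simp [initSeg, List.range_succ]

theorem initSeg_prefix {X : Set ℕ} {k l : ℕ} (h : k ≤ l) : initSeg X k <+: initSeg X l := by
  induction l, h using Nat.le_induction with
  | base => exact List.prefix_rfl
  | succ l _ ih => rw [initSeg_succ]; exact ih.trans (List.prefix_append _ _)

theorem take_initSeg {X : Set ℕ} {k l : ℕ} (h : k ≤ l) : (initSeg X l).take k = initSeg X k := by
  have := List.prefix_iff_eq_take.1 (initSeg_prefix (X := X) h)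
  rw [length_initSeg] at this
  exact this.symm

theorem strOracle_mono {σ τ : List Bool} (h : σ <+: τ) (n v : ℕ) (hv : v ∈ strOracle σ n) :
    v ∈ strOracle τ n := by
  obtain ⟨ρ, rfl⟩ := h
  simp only [strOracle, Part.mem_coe, Option.mem_def, Option.map_eq_some_iff] at hv ⊢
  obtain ⟨b, hb, rfl⟩ := hv
  obtain ⟨hlt, _⟩ := List.getElem?_eq_some_iff.1 hb
  exact ⟨b, by rw [List.getElem?_append_left hlt, hb], rfl⟩

theorem mem_strOracle_initSeg {X : Set ℕ} {k n v : ℕ} :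
    v ∈ strOracle (initSeg X k) n ↔ n < k ∧ v ∈ chi X n := by
  classical
  simp only [strOracle, initSeg, chi, Part.mem_coe, Part.mem_some_iff]
  by_cases hn : n < k
  · by_cases hX : n ∈ X <;> simp [hn, hX, eq_comm]
  · simp [hn]

/-! ### Translation to oracle-free codes -/

theorem exists_lookup_code : ∃ c : Code, ∀ (σ : List Bool) (n : ℕ),
    c.eval (Nat.pair (Encodable.encode σ) n) = strOracle σ n := by
  have h : Primrec fun p : ℕ => (((decode (α := List Bool) p.unpair.1).getD [])[p.unpair.2]?).map
      Bool.toNat :=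
    Primrec.option_map (Primrec.list_getElem?.comp
      (Primrec.option_getD.comp (Primrec.decode.comp (Primrec.fst.comp Primrec.unpair))
        (Primrec.const []))
      (Primrec.snd.comp Primrec.unpair)) ((Primrec.dom_bool Bool.toNat).comp Primrec.snd).to₂
  obtain ⟨c, hc⟩ := Code.exists_code.1 (Partrec.nat_iff.1 h.to_comp.ofOption)
  exact ⟨c, fun σ n => by rw [hc]; simp [strOracle]⟩

/-- A code that, on the pair of the number of a string and of a position, looks up the entry of the
string at this position. -/
noncomputable def lookupCode : Code := exists_lookup_code.choose

/-- The oracle-free program obtained from an oracle program by answering the queries from the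
string `σ`. -/
noncomputable def OCode.toCode (σ : List Bool) : OCode → Code
  | .zero => .zero
  | .succ => .succ
  | .left => .left
  | .right => .right
  | .oracle => Code.curry lookupCode (Encodable.encode σ)
  | .pair cf cg => .pair (toCode σ cf) (toCode σ cg)
  | .comp cf cg => .comp (toCode σ cf) (toCode σ cg)
  | .prec cf cg => .prec (toCode σ cf) (toCode σ cg)
  | .rfind cf => .comp (.rfind' (toCode σ cf)) (.pair Code.id (Code.const 0))

theorem OCode.eval_toCode (σ : List Bool) (c : OCode) :
    (c.toCode σ).eval = c.eval (strOracle σ) := by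
  induction c with
  | zero | succ | left | right => rfl
  | oracle =>
    funext n
    rw [toCode, Code.eval_curry, lookupCode, exists_lookup_code.choose_spec, eval]
  | pair cf cg ihf ihg => simp only [toCode, Code.eval, ihf, ihg, eval]; rfl
  | comp cf cg ihf ihg => simp only [toCode, Code.eval, ihf, ihg, eval]; rfl
  | prec cf cg ihf ihg => simp only [toCode, Code.eval, ihf, ihg, eval]; rfl
  | rfind cf ihf =>
    funext n
    have : Nat.pair <$> Part.some n <*> Part.some 0 = Part.some (Nat.pair n 0) := by
      simp [Seq.seq]
    simp only [toCode, Code.eval, ihf, eval, Code.eval_id, Code.eval_const, this]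
    simp [Nat.unpaired, Part.map_id']

/-- Course-of-values recursion on the number of the program. -/
theorem primrec_toCode :
    Primrec₂ fun (σ : List Bool) (e : ℕ) => (OCode.ofNat e).toCode σ := by
  let g : List Bool → List Code → Option Code := fun σ l =>
    let m := (l.length - 5) / 4
    let r := (l.length - 5) % 4
    let a := l.getD m.unpair.1 Code.zero
    let b := l.getD m.unpair.2 Code.zero
    some <|
      if l.length = 0 then .zero else if l.length = 1 then .succ
      else if l.length = 2 then .left else if l.length = 3 then .right
      else if l.length = 4 then Code.curry lookupCode (Encodable.encode σ)
      else if r = 0 then .pair a b else if r = 1 then .comp a b else if r = 2 then .prec a b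
      else .comp (.rfind' (l.getD m Code.zero)) (.pair Code.id (Code.const 0))
  have hg : Primrec₂ g := by
    have hl : Primrec fun p : List Bool × List Code => p.2.length :=
      Primrec.list_length.comp Primrec.snd
    have h5 : Primrec fun p : List Bool × List Code => p.2.length - 5 :=
      Primrec.nat_sub.comp hl (Primrec.const 5)
    have hm : Primrec fun p : List Bool × List Code => (p.2.length - 5) / 4 :=
      Primrec.nat_div.comp h5 (Primrec.const 4)
    have hr : Primrec fun p : List Bool × List Code => (p.2.length - 5) % 4 :=
      Primrec.nat_mod.comp h5 (Primrec.const 4)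
    have get : ∀ {f : List Bool × List Code → ℕ}, Primrec f →
        Primrec fun p : List Bool × List Code => p.2.getD (f p) Code.zero := fun hf =>
      (Primrec.list_getD Code.zero).comp Primrec.snd hf
    have ha := get (Primrec.fst.comp (Primrec.unpair.comp hm))
    have hb := get (Primrec.snd.comp (Primrec.unpair.comp hm))
    have eqc : ∀ {f : List Bool × List Code → ℕ} (k : ℕ), Primrec f →
        PrimrecPred fun p => f p = k := fun k hf => Primrec.eq.comp hf (Primrec.const k)
    refine Primrec.option_some.comp ?_
    refine Primrec.ite (eqc 0 hl) (Primrec.const _) ?_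
    refine Primrec.ite (eqc 1 hl) (Primrec.const _) ?_
    refine Primrec.ite (eqc 2 hl) (Primrec.const _) ?_
    refine Primrec.ite (eqc 3 hl) (Primrec.const _) ?_
    refine Primrec.ite (eqc 4 hl) (Code.primrec₂_curry.comp (Primrec.const _)
      (Primrec.encode.comp Primrec.fst)) ?_
    refine Primrec.ite (eqc 0 hr) (Code.primrec₂_pair.comp ha hb) ?_
    refine Primrec.ite (eqc 1 hr) (Code.primrec₂_comp.comp ha hb) ?_
    refine Primrec.ite (eqc 2 hr) (Code.primrec₂_prec.comp ha hb) ?_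
    exact Code.primrec₂_comp.comp (Code.primrec_rfind'.comp (get hm)) (Primrec.const _)
  refine Primrec.nat_strong_rec _ hg fun σ n => ?_
  rcases n with _ | _ | _ | _ | _ | n
  · simp [g, OCode.ofNat, OCode.toCode]
  · simp [g, OCode.ofNat, OCode.toCode]
  · simp [g, OCode.ofNat, OCode.toCode]
  · simp [g, OCode.ofNat, OCode.toCode]
  · simp [g, OCode.ofNat, OCode.toCode]
  · have h : n / 4 < n + 5 := by omega
    have h1 : (n / 4).unpair.1 < n + 5 := lt_of_le_of_lt (Nat.unpair_left_le _) h
    have h2 : (n / 4).unpair.2 < n + 5 := lt_of_le_of_lt (Nat.unpair_right_le _) h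
    have key : ∀ m < n + 5, ((List.range (n + 5)).map
        fun e => (OCode.ofNat e).toCode σ).getD m Code.zero = (OCode.ofNat m).toCode σ := by
      intro m hm
      simp [List.getD, hm]
    have h5 : n + 5 - 5 = n := rfl
    have hn : ∀ k < 5, n + 5 ≠ k := by omega
    change g σ ((List.range (n + 5)).map fun e => (OCode.ofNat e).toCode σ) = _
    simp only [g, List.length_map, List.length_range, h5, key _ h, key _ h1, key _ h2,
      hn 0 (by decide), hn 1 (by decide), hn 2 (by decide), hn 3 (by decide), hn 4 (by decide),
      if_false, OCode.ofNat]
    have h4 : n % 4 < 4 := Nat.mod_lt _ (by norm_num)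
    congr 1
    generalize n % 4 = r at *
    interval_cases r <;> simp [OCode.toCode]

/-! ### Clocked evaluation along a string -/

/-- The value of the `e`-th oracle program at `x` found by running it for `σ.length` steps on each
of the prefixes of `σ`. Trying all prefixes makes the result monotone in `σ`, although the running
time of the translated program depends on the string. -/
noncomputable def strEval (σ : List Bool) (e x : ℕ) : Option ℕ :=
  ((List.range (σ.length + 1)).filterMap fun l =>
    Code.evaln σ.length ((OCode.ofNat e).toCode (σ.take l)) x).head?

theorem primrec_strEval :
    Primrec fun p : List Bool × ℕ × ℕ => strEval p.1 p.2.1 p.2.2 := by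
  have hl : Primrec fun p : List Bool × ℕ × ℕ => p.1.length :=
    Primrec.list_length.comp Primrec.fst
  refine Primrec.list_head?.comp (Primrec.listFilterMap
    (Primrec.list_range.comp (Primrec.succ.comp hl)) ?_)
  exact Code.primrec_evaln.comp (Primrec.pair (Primrec.pair (hl.comp Primrec.fst)
    (primrec_toCode.comp (Primrec.list_take.comp Primrec.snd (Primrec.fst.comp Primrec.fst))
      (Primrec.fst.comp (Primrec.snd.comp Primrec.fst))))
    (Primrec.snd.comp (Primrec.snd.comp Primrec.fst)))

theorem strEval_sound {σ : List Bool} {e x v : ℕ} (h : v ∈ strEval σ e x) :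
    v ∈ (OCode.ofNat e).eval (strOracle σ) x := by
  have h := List.mem_of_mem_head? h
  obtain ⟨l, _, hl⟩ := List.mem_filterMap.1 h
  have := Code.evaln_sound hl
  rw [OCode.eval_toCode] at this
  exact OCode.eval_mono (strOracle_mono (List.take_prefix _ _)) this

theorem mem_strEval_of_mem_evaln {σ : List Bool} {e x v : ℕ} (l : ℕ) (hl : l ≤ σ.length)
    (h : v ∈ Code.evaln σ.length ((OCode.ofNat e).toCode (σ.take l)) x) : v ∈ strEval σ e x := by
  have hne : ∃ u, u ∈ strEval σ e x := by
    rw [show (∃ u, u ∈ strEval σ e x) ↔ _ from Option.isSome_iff_exists.symm, strEval,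
      List.isSome_head?]
    exact List.ne_nil_of_mem (List.mem_filterMap.2 ⟨l, by simpa [Nat.lt_succ_iff] using hl, h⟩)
  obtain ⟨u, hu⟩ := hne
  have h1 := strEval_sound hu
  have h2 := Code.evaln_sound h
  rw [OCode.eval_toCode] at h2
  have h3 := OCode.eval_mono (strOracle_mono (List.take_prefix _ _)) h2
  rwa [Part.mem_unique h3 h1]

theorem strEval_mono {σ τ : List Bool} {e x v : ℕ} (hp : σ <+: τ) (h : v ∈ strEval σ e x) :
    v ∈ strEval τ e x := by
  obtain ⟨l, hl, hv⟩ := List.mem_filterMap.1 (List.mem_of_mem_head? h)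
  have hl : l ≤ σ.length := Nat.lt_succ_iff.1 (List.mem_range.1 hl)
  refine mem_strEval_of_mem_evaln l (hl.trans hp.length_le) (Code.evaln_mono hp.length_le ?_)
  obtain ⟨ρ, rfl⟩ := hp
  rwa [List.take_append_of_le_length hl]

/-- The use principle, in effective form. -/
theorem mem_Phi_iff {X : Set ℕ} {e x v : ℕ} :
    v ∈ Phi e X x ↔ ∃ k, v ∈ strEval (initSeg X k) e x := by
  constructor
  · intro h
    have h1 := OCode.eventually_mem_eval (O := chi X) (P := fun k => strOracle (initSeg X k))
      (fun n v hv => (eventually_gt_atTop n).mono fun k hk => mem_strOracle_initSeg.2 ⟨hk, hv⟩)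
      _ _ _ h
    obtain ⟨l, hl⟩ := h1.exists
    rw [← OCode.eval_toCode] at hl
    obtain ⟨k, hk⟩ := Code.evaln_complete.1 hl
    refine ⟨max k l, mem_strEval_of_mem_evaln l (by simp) ?_⟩
    rw [take_initSeg (le_max_right _ _), length_initSeg]
    exact Code.evaln_mono (le_max_left _ _) hk
  · rintro ⟨k, hk⟩
    exact OCode.eval_mono (fun n v hv => (mem_strOracle_initSeg.1 hv).2) (strEval_sound hk)

/-! ### Programs and indices, uniformly in the oracle -/

namespace OCode

/-- A partial recursive function is computed by one program, whatever the oracle. -/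
theorem exists_of_partrec {φ : ℕ →. ℕ} (h : Nat.Partrec φ) : ∃ c : OCode, ∀ O, eval O c = φ := by
  induction h with
  | zero => exact ⟨zero, fun _ => rfl⟩
  | succ => exact ⟨succ, fun _ => rfl⟩
  | left => exact ⟨left, fun _ => rfl⟩
  | right => exact ⟨right, fun _ => rfl⟩
  | pair _ _ ihf ihg =>
    obtain ⟨cf, hf⟩ := ihf; obtain ⟨cg, hg⟩ := ihg
    exact ⟨pair cf cg, fun O => by simp only [eval, hf, hg]; rfl⟩
  | comp _ _ ihf ihg =>
    obtain ⟨cf, hf⟩ := ihf; obtain ⟨cg, hg⟩ := ihg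
    exact ⟨comp cf cg, fun O => by simp only [eval, hf, hg]; rfl⟩
  | prec _ _ ihf ihg =>
    obtain ⟨cf, hf⟩ := ihf; obtain ⟨cg, hg⟩ := ihg
    exact ⟨prec cf cg, fun O => by simp only [eval, hf, hg]; rfl⟩
  | rfind _ ihf => obtain ⟨cf, hf⟩ := ihf; exact ⟨rfind cf, fun O => by simp only [eval, hf]; rfl⟩

theorem exists_of_computable {g : ℕ → ℕ} (h : Computable g) :
    ∃ c : OCode, ∀ O n, eval O c n = Part.some (g n) := by
  obtain ⟨c, hc⟩ := exists_of_partrec (Partrec.nat_iff.1 h.partrec)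
  exact ⟨c, fun O n => by rw [hc]; rfl⟩

theorem eval_pair_of_eq {O : ℕ →. ℕ} {cf cg : OCode} {n a b : ℕ} (hf : eval O cf n = Part.some a)
    (hg : eval O cg n = Part.some b) : eval O (pair cf cg) n = Part.some (Nat.pair a b) := by
  simp [eval, hf, hg, Seq.seq]

theorem eval_comp_of_eq {O : ℕ →. ℕ} {cf cg : OCode} {n a : ℕ} (hg : eval O cg n = Part.some a) :
    eval O (comp cf cg) n = eval O cf a := by
  simp only [eval, hg]; exact Part.bind_some _ _

/-- The program for the constant function with value `a`. -/
def const : ℕ → OCode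
  | 0 => zero
  | a + 1 => comp succ (const a)

theorem eval_const (O : ℕ →. ℕ) (a n : ℕ) : eval O (const a) n = Part.some a := by
  induction a with
  | zero => rfl
  | succ a ih => rw [const, eval_comp_of_eq ih]; rfl

theorem primrec_encode_const : Primrec fun a => encode (const a) := by
  have h : Primrec₂ fun (_ : ℕ) (i : ℕ) => 4 * Nat.pair 1 i + 6 :=
    (Primrec.nat_add.comp (Primrec.nat_mul.comp (Primrec.const 4)
      (Primrec₂.natPair.comp (Primrec.const 1) Primrec.snd)) (Primrec.const 6)).to₂
  refine (Primrec.nat_rec₁ (encode zero) h).of_eq fun a => ?_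
  induction a with
  | zero => rfl
  | succ a ih => simp only [ih]; rfl

/-- The program for the identity. -/
def id : OCode := pair left right

theorem eval_id (O : ℕ →. ℕ) (n : ℕ) : eval O id n = Part.some n := by
  rw [id, eval_pair_of_eq (a := n.unpair.1) (b := n.unpair.2) rfl rfl, Nat.pair_unpair]

theorem primrec_encode_comp {c : OCode} {d : ℕ → OCode} (h : Primrec fun a => encode (d a)) :
    Primrec fun a => encode (comp c (d a)) :=
  Primrec.nat_add.comp (Primrec.nat_mul.comp (Primrec.const 4)
    (Primrec₂.natPair.comp (Primrec.const _) h)) (Primrec.const 6)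

theorem primrec_encode_pair {c : OCode} {d : ℕ → OCode} (h : Primrec fun a => encode (d a)) :
    Primrec fun a => encode (pair (d a) c) :=
  Primrec.nat_add.comp (Primrec.nat_mul.comp (Primrec.const 4)
    (Primrec₂.natPair.comp h (Primrec.const _))) (Primrec.const 5)

end OCode

/-- The `s-m-n` theorem for programs with an oracle. -/
theorem exists_Phi_index (c : OCode) :
    ∃ f : ℕ → ℕ, Computable f ∧ ∀ X a n, Phi (f a) X n = c.eval (chi X) (Nat.pair a n) := by
  refine ⟨fun a => (OCode.comp c (.pair (.const a) .id)).encode,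
    (OCode.primrec_encode_comp (OCode.primrec_encode_pair OCode.primrec_encode_const)).to_comp,
    fun X a n => ?_⟩
  rw [Phi, OCode.ofNat_encode,
    OCode.eval_comp_of_eq (OCode.eval_pair_of_eq (OCode.eval_const _ a n) (OCode.eval_id _ n))]

/-- Every oracle program is many-one reducible to the jump function, by a function that does not
depend on the oracle. -/
theorem exists_J_index (c : OCode) :
    ∃ h : ℕ → ℕ, Computable h ∧ ∀ X a, J X (h a) = c.eval (chi X) a := by
  refine ⟨fun a => (OCode.comp c (.const a)).encode,
    (OCode.primrec_encode_comp OCode.primrec_encode_const).to_comp, fun X a => ?_⟩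
  rw [J, Phi, OCode.ofNat_encode, OCode.eval_comp_of_eq (OCode.eval_const _ a _)]

/-- Initial segments of the oracle are computable, uniformly in the oracle. -/
theorem exists_initSeg_code :
    ∃ c : OCode, ∀ X k, c.eval (chi X) k = Part.some (encode (initSeg X k)) := by
  classical
  have hp : Primrec fun p : ℕ =>
      encode ((decode (α := List Bool) p.unpair.2).getD [] ++ [decide (p.unpair.1 = 1)]) :=
    Primrec.encode.comp (Primrec.list_concat.comp
      (Primrec.option_getD.comp (Primrec.decode.comp (Primrec.snd.comp Primrec.unpair))
        (Primrec.const []))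
      (Primrec.eq.decide.comp (Primrec.fst.comp Primrec.unpair) (Primrec.const 1)))
  obtain ⟨cp, hcp⟩ := OCode.exists_of_computable hp.to_comp
  let cg : OCode := .comp cp (.pair (.comp .oracle (.comp .left .right)) (.comp .right .right))
  let cr : OCode := .prec (.const (encode ([] : List Bool))) cg
  have hr : ∀ X k, cr.eval (chi X) (Nat.pair 0 k) = Part.some (encode (initSeg X k)) := by
    intro X k
    simp only [cr, OCode.eval, Nat.unpaired, Nat.unpair_pair]
    induction k with
    | zero => exact OCode.eval_const _ _ _
    | succ k ih =>
      simp only [ih]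
      refine (Part.bind_some _ _).trans ?_
      have h1 : (OCode.comp .left .right).eval (chi X)
          (Nat.pair 0 (Nat.pair k (encode (initSeg X k)))) = Part.some k := by
        rw [OCode.eval_comp_of_eq (a := Nat.pair k (encode (initSeg X k))) (by simp [OCode.eval])]
        simp [OCode.eval]
      have h2 : (OCode.comp .right .right).eval (chi X)
          (Nat.pair 0 (Nat.pair k (encode (initSeg X k)))) =
            Part.some (encode (initSeg X k)) := by
        rw [OCode.eval_comp_of_eq (a := Nat.pair k (encode (initSeg X k))) (by simp [OCode.eval])]
        simp [OCode.eval]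
      have h3 := OCode.eval_comp_of_eq (cf := .oracle) h1
      rw [OCode.eval_comp_of_eq (OCode.eval_pair_of_eq h3 h2), hcp, initSeg_succ]
      by_cases hk : k ∈ X <;> simp [hk]
  refine ⟨.comp cr (.pair .zero .id), fun X k => ?_⟩
  rw [OCode.eval_comp_of_eq (OCode.eval_pair_of_eq (a := 0) rfl (OCode.eval_id _ k)), hr]

/-- A computable function of a number and of an initial segment of the oracle whose length is the
second component of this number. -/
theorem exists_code_initSeg {G : ℕ → List Bool → ℕ} (hG : Computable₂ G) :
    ∃ c : OCode, ∀ X a, c.eval (chi X) a = Part.some (G a (initSeg X a.unpair.2)) := by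
  obtain ⟨ci, hi⟩ := exists_initSeg_code
  have hg : Computable fun p : ℕ => G p.unpair.1 ((decode (α := List Bool) p.unpair.2).getD []) :=
    hG.comp (Computable.fst.comp Computable.unpair) (Computable.option_getD
      (Computable.decode.comp (Computable.snd.comp Computable.unpair)) (Computable.const []))
  obtain ⟨cg, hcg⟩ := OCode.exists_of_computable hg
  refine ⟨.comp cg (.pair .id (.comp ci .right)), fun X a => ?_⟩
  have h1 : (OCode.comp ci .right).eval (chi X) a =
      Part.some (encode (initSeg X a.unpair.2)) := by
    rw [OCode.eval_comp_of_eq (a := a.unpair.2) rfl, hi]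
  rw [OCode.eval_comp_of_eq (OCode.eval_pair_of_eq (OCode.eval_id _ a) h1), hcg]
  simp

/-- Unbounded search for a `k` such that a computable condition holds of the input, of `k`, and of
the first `k` values of the oracle. -/
theorem exists_search_code {D : ℕ → List Bool → Bool} (hD : Computable₂ D) :
    ∃ c : OCode, ∀ X n, c.eval (chi X) n =
      Nat.rfind fun k => Part.some (D (Nat.pair n k) (initSeg X k)) := by
  have hG : Computable₂ fun a σ => cond (D a σ) 0 1 :=
    Computable.cond hD (Computable.const 0) (Computable.const 1)
  obtain ⟨c, hc⟩ := exists_code_initSeg hG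
  refine ⟨.rfind c, fun X n => ?_⟩
  simp only [OCode.eval, hc, Nat.unpair_pair]
  congr 1
  funext k
  cases D (Nat.pair n k) (initSeg X k) <;> simp

theorem search_dom {D : ℕ → Bool} : (Nat.rfind fun k => Part.some (D k)).Dom ↔ ∃ k, D k := by
  constructor
  · intro h
    exact ⟨_, (Part.mem_some_iff.1 (Nat.rfind_spec (Part.get_mem h))).symm⟩
  · rintro ⟨k, hk⟩
    obtain ⟨n, hn, _⟩ := Nat.rfind_min' (p := D) hk
    exact Part.dom_iff_mem.2 ⟨n, hn⟩

/-! ### Hardness contradicts traceability -/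

/-- The elements of `W e X` found below the length of the initial segment `σ` of `X`. -/
noncomputable def stageList (σ : List Bool) (e : ℕ) : List ℕ :=
  (List.range σ.length).filterMap fun x => (strEval σ e x).map fun _ => x

theorem mem_stageList {σ : List Bool} {e x : ℕ} :
    x ∈ stageList σ e ↔ x < σ.length ∧ (strEval σ e x).isSome := by
  simp [stageList, Option.isSome_iff_exists]

theorem nodup_stageList (σ : List Bool) (e : ℕ) : (stageList σ e).Nodup := by
  have : stageList σ e = (List.range σ.length).filter fun x => (strEval σ e x).isSome := by
    rw [stageList, ← List.filterMap_eq_filter]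
    congr 1
    funext x
    cases h : strEval σ e x <;> simp [Option.guard, h]
  rw [this]
  exact List.nodup_range.filter _

theorem primrec_stageList : Primrec₂ stageList := by
  refine Primrec.listFilterMap
    (Primrec.list_range.comp (Primrec.list_length.comp Primrec.fst)) ?_
  exact Primrec.option_map (primrec_strEval.comp (Primrec.pair (Primrec.fst.comp Primrec.fst)
    (Primrec.pair (Primrec.snd.comp Primrec.fst) Primrec.snd)))
    (Primrec.snd.comp Primrec.fst).to₂

theorem eventually_strEval_isSome {X : Set ℕ} {e x : ℕ} (h : x ∈ W e X) :
    ∀ᶠ k in atTop, (strEval (initSeg X k) e x).isSome := by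
  obtain ⟨v, hv⟩ := Part.dom_iff_mem.1 h
  obtain ⟨k, hk⟩ := mem_Phi_iff.1 hv
  filter_upwards [eventually_ge_atTop k] with l hl
  exact Option.isSome_iff_exists.2 ⟨v, strEval_mono (initSeg_prefix hl) hk⟩

theorem mem_W_of_strEval_isSome {X : Set ℕ} {e x k : ℕ}
    (h : (strEval (initSeg X k) e x).isSome) : x ∈ W e X := by
  obtain ⟨v, hv⟩ := Option.isSome_iff_exists.1 h
  exact Part.dom_iff_mem.2 ⟨v, mem_Phi_iff.2 ⟨k, hv⟩⟩

/-- If `W (f n) X` is finite, a program with oracle `X` that is told its number of elements `m` can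
list it. -/
theorem exists_listing_code {f : ℕ → ℕ} (hf : Computable f) :
    ∃ c : OCode, ∀ X n, (W (f n) X).Finite →
      ∃ L ∈ c.eval (chi X) (Nat.pair n (W (f n) X).ncard),
        ∀ x ∈ W (f n) X, x ∈ Denumerable.ofNat (List ℕ) L := by
  have hfst : Computable fun a : ℕ × List Bool => f a.1.unpair.1.unpair.1 :=
    hf.comp (Computable.fst.comp (Computable.unpair.comp
      (Computable.fst.comp (Computable.unpair.comp Computable.fst))))
  have hlist : Computable fun a : ℕ × List Bool => stageList a.2 (f a.1.unpair.1.unpair.1) :=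
    primrec_stageList.to_comp.comp Computable.snd hfst
  have hD : Computable₂ fun (a : ℕ) (σ : List Bool) =>
      decide ((stageList σ (f a.unpair.1.unpair.1)).length = a.unpair.1.unpair.2) :=
    Primrec.eq.decide.to_comp.comp (Computable.list_length.comp hlist)
      (Computable.snd.comp (Computable.unpair.comp
        (Computable.fst.comp (Computable.unpair.comp Computable.fst))))
  obtain ⟨cs, hs⟩ := exists_search_code hD
  have hG : Computable₂ fun (a : ℕ) (σ : List Bool) =>
      encode (stageList σ (f a.unpair.1.unpair.1)) := Computable.encode.comp hlist
  obtain ⟨cl, hl⟩ := exists_code_initSeg hG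
  refine ⟨.comp cl (.pair .id cs), fun X n hfin => ?_⟩
  -- at a late enough stage the list contains all elements, so the search succeeds
  have hall : ∀ᶠ k in atTop, ∀ x ∈ W (f n) X,
      x < k ∧ (strEval (initSeg X k) (f n) x).isSome :=
    hfin.eventually_all.2 fun x hx =>
      (eventually_gt_atTop x).and (eventually_strEval_isSome hx)
  have hsub : ∀ k, (stageList (initSeg X k) (f n)).toFinset ⊆ hfin.toFinset := by
    intro k x hx
    rw [List.mem_toFinset, mem_stageList] at hx
    exact hfin.mem_toFinset.2 (mem_W_of_strEval_isSome hx.2)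
  have hcard : ∀ k, (stageList (initSeg X k) (f n)).length =
      (stageList (initSeg X k) (f n)).toFinset.card := fun k =>
    (List.toFinset_card_of_nodup (nodup_stageList _ _)).symm
  obtain ⟨k₀, hk₀⟩ := hall.exists
  have hex : ∃ k, decide ((stageList (initSeg X k) (f n)).length = (W (f n) X).ncard) = true := by
    refine ⟨k₀, decide_eq_true ?_⟩
    rw [hcard, Set.ncard_eq_toFinset_card _ hfin]
    congr 1
    refine (hsub k₀).antisymm fun x hx => ?_
    rw [List.mem_toFinset, mem_stageList, length_initSeg]
    exact hk₀ x (hfin.mem_toFinset.1 hx)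
  obtain ⟨k, hk⟩ := Part.dom_iff_mem.1 (search_dom.2 hex)
  have hkD := of_decide_eq_true (Part.mem_some_iff.1 (Nat.rfind_spec hk)).symm
  have hev : cs.eval (chi X) (Nat.pair n (W (f n) X).ncard) = Part.some k := by
    rw [hs]
    simpa using Part.eq_some_iff.2 hk
  refine ⟨encode (stageList (initSeg X k) (f n)), ?_, fun x hx => ?_⟩
  · rw [OCode.eval_comp_of_eq (OCode.eval_pair_of_eq (OCode.eval_id _ _) hev), hl]
    simp
  · rw [hcard, Set.ncard_eq_toFinset_card _ hfin] at hkD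
    have := Finset.eq_of_subset_of_card_le (hsub k) hkD.ge
    rw [Denumerable.ofNat_encode, ← List.mem_toFinset, this]
    exact hfin.mem_toFinset.2 hx

/-- `J^{∅'}` escapes every uniformly c.e. sequence of finite sets: `∅'` can compute the least
element outside of the `n`-th set. -/
theorem exists_J_jump_notMem {S : ℕ → Set ℕ} (hfin : ∀ n, (S n).Finite) {r : ℕ → ℕ}
    (hr : Computable r) (hS : ∀ n y, r (Nat.pair n y) ∈ jump ∅ ↔ y ∈ S n) :
    ∃ n, ∃ y ∈ J (jump ∅) n, y ∉ S n := by
  classical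
  obtain ⟨c, hc⟩ := OCode.exists_of_computable hr
  let d : OCode := .rfind (.comp .oracle c)
  refine ⟨d.encode, ?_⟩
  have hev : ∀ y, (OCode.comp .oracle c).eval (chi (jump ∅)) (Nat.pair d.encode y) =
      Part.some (if y ∈ S d.encode then 1 else 0) := by
    intro y
    rw [OCode.eval_comp_of_eq (hc _ _)]
    simp only [OCode.eval, chi, hS]
  have hJ : J (jump ∅) d.encode =
      Nat.rfind fun y => Part.some (decide (y ∉ S d.encode)) := by
    rw [J, Phi, OCode.ofNat_encode]
    change (Nat.rfind fun y => (fun m => decide (m = 0)) <$>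
      (OCode.comp .oracle c).eval (chi (jump ∅)) (Nat.pair d.encode y)) = _
    congr 1
    funext y
    rw [hev]
    by_cases hy : y ∈ S d.encode <;> simp [hy]
  obtain ⟨y₀, hy₀⟩ := (hfin d.encode).exists_notMem
  obtain ⟨y, hy⟩ := Part.dom_iff_mem.1
    (search_dom (D := fun y => decide (y ∉ S d.encode)).2 ⟨y₀, by simpa using hy₀⟩)
  refine ⟨y, hJ ▸ hy, ?_⟩
  simpa using Nat.rfind_spec hy

theorem primrec_decide_mem :
    Primrec₂ fun y v : ℕ => decide (y ∈ Denumerable.ofNat (List ℕ) v) := by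
  have hL : Primrec fun p : ℕ × ℕ => Denumerable.ofNat (List ℕ) p.2 :=
    (Primrec.ofNat (List ℕ)).comp Primrec.snd
  exact (Primrec.nat_lt.decide.comp (Primrec.list_idxOf.comp Primrec.fst hL)
    (Primrec.list_length.comp hL)).of_eq fun p => by simp [List.idxOf_lt_length_iff]

/-- If `∅'` is jump traceable by `B` and `B` is jump traceable, then composing the traces shows that
`∅'` is jump traceable, which is impossible. -/
theorem not_JTHard_of_jumpTraceable {B : Set ℕ} (hB : JumpTraceable B) : ¬ JTHard B := by
  rintro ⟨g, hg, f, hf, htr⟩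
  obtain ⟨g₀, -, f₀, hf₀, htr₀⟩ := hB
  obtain ⟨c, hc⟩ := exists_listing_code hf
  obtain ⟨h, hh, hJ⟩ := exists_J_index c
  -- the union of the traces of all listings of `W (f n) B`, over the possible numbers of elements
  let S : ℕ → Set ℕ := fun n => {y | ∃ m ≤ g n, ∃ v ∈ W (f₀ (h (Nat.pair n m))) ∅,
    y ∈ Denumerable.ofNat (List ℕ) v}
  have hfin : ∀ n, (S n).Finite := by
    intro n
    have : S n ⊆ ⋃ m ∈ Set.Iic (g n), ⋃ v ∈ W (f₀ (h (Nat.pair n m))) ∅,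
        {y | y ∈ Denumerable.ofNat (List ℕ) v} := by
      rintro y ⟨m, hm, v, hv, hy⟩
      simp only [Set.mem_iUnion]
      exact ⟨m, hm, v, hv, hy⟩
    refine Set.Finite.subset ?_ this
    exact (Set.finite_Iic _).biUnion fun m _ => (htr₀ _).2.1.biUnion fun v _ =>
      List.finite_toSet _
  have hD : Computable₂ fun (a : ℕ) (σ : List Bool) =>
      (decide (a.unpair.2.unpair.1 ≤ g a.unpair.1.unpair.1) &&
        decide (a.unpair.1.unpair.2 ∈
          Denumerable.ofNat (List ℕ) a.unpair.2.unpair.2.unpair.1)) &&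
      (strEval σ (f₀ (h (Nat.pair a.unpair.1.unpair.1 a.unpair.2.unpair.1)))
        a.unpair.2.unpair.2.unpair.1).isSome := by
    have u : Computable fun p : ℕ × List Bool => p.1.unpair := Computable.unpair.comp Computable.fst
    have u1 : Computable fun p : ℕ × List Bool => p.1.unpair.1.unpair :=
      Computable.unpair.comp (Computable.fst.comp u)
    have u2 : Computable fun p : ℕ × List Bool => p.1.unpair.2.unpair :=
      Computable.unpair.comp (Computable.snd.comp u)
    have hv : Computable fun p : ℕ × List Bool => p.1.unpair.2.unpair.2.unpair.1 :=
      Computable.fst.comp (Computable.unpair.comp (Computable.snd.comp u2))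
    have hle : Computable fun p : ℕ × List Bool =>
        decide (p.1.unpair.2.unpair.1 ≤ g p.1.unpair.1.unpair.1) :=
      Primrec.nat_le.decide.to_comp.comp (Computable.fst.comp u2)
        (hg.comp (Computable.fst.comp u1))
    have hidx : Computable fun p : ℕ × List Bool => decide
        (p.1.unpair.1.unpair.2 ∈ Denumerable.ofNat (List ℕ) p.1.unpair.2.unpair.2.unpair.1) :=
      primrec_decide_mem.to_comp.comp (Computable.snd.comp u1) hv
    have hp : Computable fun p : ℕ × List Bool =>
        Nat.pair p.1.unpair.1.unpair.1 p.1.unpair.2.unpair.1 :=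
      Primrec₂.natPair.to_comp.comp (Computable.fst.comp u1) (Computable.fst.comp u2)
    have hev : Computable fun p : ℕ × List Bool =>
        (strEval p.2 (f₀ (h (Nat.pair p.1.unpair.1.unpair.1 p.1.unpair.2.unpair.1)))
          p.1.unpair.2.unpair.2.unpair.1).isSome :=
      Primrec.option_isSome.to_comp.comp (primrec_strEval.to_comp.comp
        (Computable.pair Computable.snd (Computable.pair (hf₀.comp (hh.comp hp)) hv)))
    exact Primrec.and.to_comp.comp (Primrec.and.to_comp.comp hle hidx) hev
  obtain ⟨cS, hcS⟩ := exists_search_code hD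
  obtain ⟨r, hr, hrJ⟩ := exists_J_index cS
  have hS : ∀ n y, r (Nat.pair n y) ∈ jump ∅ ↔ y ∈ S n := by
    intro n y
    change (J ∅ (r (Nat.pair n y))).Dom ↔ _
    rw [hrJ, hcS, search_dom]
    simp only [Nat.unpair_pair, Bool.and_eq_true, decide_eq_true_eq]
    constructor
    · rintro ⟨k, ⟨hm, hy⟩, hv⟩
      exact ⟨_, hm, _, mem_W_of_strEval_isSome hv, hy⟩
    · rintro ⟨m, hm, v, hv, hy⟩
      obtain ⟨s, hs⟩ := eventually_atTop.1 (eventually_strEval_isSome hv)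
      refine ⟨Nat.pair m (Nat.pair v s), ?_⟩
      simp only [Nat.unpair_pair]
      exact ⟨⟨hm, hy⟩, hs _ ((Nat.right_le_pair _ _).trans (Nat.right_le_pair _ _))⟩
  obtain ⟨n, y, hy, hyS⟩ := exists_J_jump_notMem hfin hr hS
  obtain ⟨h1, h2, h3⟩ := htr n
  obtain ⟨L, hL, hLW⟩ := hc B n h2
  rw [← hJ] at hL
  exact hyS ⟨_, h3, L, (htr₀ _).1 _ hL, hLW _ (h1 _ hy)⟩

/-- A sequence with fewer than `g` changes has at most `g` values. -/
theorem ncard_range_le {u : ℕ → ℕ} {g : ℕ} (hfin : {s | u s ≠ u (s + 1)}.Finite)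
    (hg : {s | u s ≠ u (s + 1)}.ncard < g) : (Set.range u).Finite ∧ (Set.range u).ncard ≤ g := by
  have hsub : Set.range u ⊆ insert (u 0) ((fun s => u (s + 1)) '' {s | u s ≠ u (s + 1)}) := by
    rintro _ ⟨s, rfl⟩
    induction s with
    | zero => exact Set.mem_insert _ _
    | succ s ih =>
      by_cases h : u s = u (s + 1)
      · rwa [← h]
      · exact Set.mem_insert_of_mem _ ⟨s, h, rfl⟩
  have hfin' := (hfin.image fun s => u (s + 1)).insert (u 0)
  refine ⟨hfin'.subset hsub, (Set.ncard_le_ncard hsub hfin').trans ?_⟩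
  refine (Set.ncard_insert_le _ _).trans ?_
  exact (Nat.add_le_add_right (Set.ncard_image_le hfin) 1).trans hg

theorem exists_code_of_computableIn₂ {X : Set ℕ} {F : ℕ → ℕ → ℕ} (hF : ComputableIn₂ {chi X} F) :
    ∃ c : OCode, ∀ n s, c.eval (chi X) (Nat.pair n s) = Part.some (F n s) := by
  obtain ⟨c, hc⟩ := OCode.recursiveIn_iff.1 hF
  refine ⟨c, fun n s => ?_⟩
  rw [hc]
  simp

theorem computableIn₂_of_code {X : Set ℕ} {F : ℕ → ℕ → ℕ} {c : OCode}
    (hc : ∀ n s, c.eval (chi X) (Nat.pair n s) = Part.some (F n s)) : ComputableIn₂ {chi X} F := by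
  refine OCode.recursiveIn_iff.2 ⟨c, funext fun a => ?_⟩
  rw [← Nat.pair_unpair a, hc]
  simp

/-- The function with value `J^{∅'}(n) + 1` where this is defined, and `0` elsewhere, is in
`BLR ∅'` with at most one change. A function in `BLR B` is traced by the values of its
approximation. -/
theorem JTHard_of_BLRHard {B : Set ℕ} (h : BLRHard B) : JTHard B := by
  let F : ℕ → ℕ → ℕ := fun n s => ((strEval (initSeg (jump ∅) s) n n).map Nat.succ).getD 0
  have hF : ComputableIn₂ {chi (jump ∅)} F := by
    have hG : Computable₂ fun (a : ℕ) (σ : List Bool) =>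
        ((strEval σ a.unpair.1 a.unpair.1).map Nat.succ).getD 0 := by
      have u : Computable fun p : ℕ × List Bool => p.1.unpair.1 :=
        Computable.fst.comp (Computable.unpair.comp Computable.fst)
      exact Computable.option_getD (Computable.option_map (primrec_strEval.to_comp.comp
        (Computable.pair Computable.snd (Computable.pair u u)))
        (Computable.succ.comp Computable.snd).to₂) (Computable.const 0)
    obtain ⟨c, hc⟩ := exists_code_initSeg hG
    exact computableIn₂_of_code (c := c) fun n s => by rw [hc]; simp [F]
  have hval : ∀ {n s v}, v ∈ strEval (initSeg (jump ∅) s) n n → ∀ t ≥ s, F n t = v + 1 := by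
    intro n s v hv t ht
    have := strEval_mono (initSeg_prefix ht) hv
    simp only [F, Option.mem_def.1 this, Option.map_some, Option.getD_some]
  have hzero : ∀ {n s}, F n s ≠ 0 → ∃ v, v ∈ strEval (initSeg (jump ∅) s) n n := by
    intro n s hs
    by_contra hcon
    push Not at hcon
    exact hs (by simp [F, Option.eq_none_iff_forall_not_mem.2 hcon])
  have hlim : ∀ n, ∃ v, ∃ s₀, ∀ s ≥ s₀, F n s = v := by
    intro n
    by_cases hn : ∃ s, F n s ≠ 0
    · obtain ⟨s, hs⟩ := hn
      obtain ⟨v, hv⟩ := hzero hs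
      exact ⟨v + 1, s, hval hv⟩
    · push Not at hn
      exact ⟨0, 0, fun s _ => hn s⟩
  choose f hf using hlim
  have hsub : ∀ n, {s | F n s ≠ F n (s + 1)}.Subsingleton := by
    have key : ∀ n s t, F n s ≠ F n (s + 1) → s < t → F n t = F n (t + 1) := by
      intro n s t hs hst
      have h1 : F n (s + 1) ≠ 0 := by
        intro h1
        rw [h1] at hs
        obtain ⟨v, hv⟩ := hzero hs
        simp [hval hv (s + 1) (Nat.le_succ s)] at h1
      obtain ⟨v, hv⟩ := hzero h1
      rw [hval hv t hst, hval hv (t + 1) (by omega)]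
    intro n s hs t ht
    rcases lt_trichotomy s t with hlt | heq | hlt
    · exact absurd (key n s t hs hlt) ht
    · exact heq
    · exact absurd (key n t s ht hlt) hs
  have hmem : f ∈ BLR (jump ∅) := by
    refine ⟨F, hF, hf, fun _ => 2, Computable.const 2, fun n => ⟨(hsub n).finite, ?_⟩⟩
    exact lt_of_le_of_lt ((Set.ncard_le_one (hsub n).finite).2 fun a ha b hb => hsub n ha hb)
      one_lt_two
  obtain ⟨F', hF', hlim', g, hg, hchg⟩ := h hmem
  obtain ⟨c, hc⟩ := exists_code_of_computableIn₂ hF'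
  -- a program that, given `n` and `y`, searches for a stage `s` with `F' n s = y + 1`
  have hE : Computable fun p : ℕ => cond (decide (p.unpair.1 = p.unpair.2 + 1)) 0 1 :=
    Computable.cond (Primrec.eq.decide.to_comp.comp (Computable.fst.comp Computable.unpair)
      (Computable.succ.comp (Computable.snd.comp Computable.unpair)))
      (Computable.const 0) (Computable.const 1)
  obtain ⟨cE, hcE⟩ := OCode.exists_of_computable hE
  let d : OCode := .rfind (.comp cE (.pair
    (.comp c (.pair (.comp .left .left) .right)) (.comp .right .left)))
  have hd : ∀ n y, d.eval (chi B) (Nat.pair n y) =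
      Nat.rfind fun s => Part.some (decide (F' n s = y + 1)) := by
    intro n y
    change (Nat.rfind fun s => (fun m => decide (m = 0)) <$> OCode.eval (chi B) (.comp cE (.pair
      (.comp c (.pair (.comp .left .left) .right)) (.comp .right .left)))
      (Nat.pair (Nat.pair n y) s)) = _
    congr 1
    funext s
    have h0 : OCode.left.eval (chi B) (Nat.pair (Nat.pair n y) s) = Part.some (Nat.pair n y) := by
      simp [OCode.eval]
    have h1 : (OCode.comp .left .left).eval (chi B) (Nat.pair (Nat.pair n y) s) = Part.some n := by
      rw [OCode.eval_comp_of_eq h0]; simp [OCode.eval]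
    have h2 : (OCode.comp .right .left).eval (chi B) (Nat.pair (Nat.pair n y) s) = Part.some y := by
      rw [OCode.eval_comp_of_eq h0]; simp [OCode.eval]
    have h3 : OCode.right.eval (chi B) (Nat.pair (Nat.pair n y) s) = Part.some s := by
      simp [OCode.eval]
    have h4 : (OCode.comp c (.pair (.comp .left .left) .right)).eval (chi B)
        (Nat.pair (Nat.pair n y) s) = Part.some (F' n s) := by
      rw [OCode.eval_comp_of_eq (OCode.eval_pair_of_eq h1 h3), hc]
    rw [OCode.eval_comp_of_eq (OCode.eval_pair_of_eq h4 h2), hcE]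
    by_cases hy : F' n s = y + 1 <;> simp [hy]
  obtain ⟨f', hf', hPhi⟩ := exists_Phi_index d
  have hW : ∀ n y, y ∈ W (f' n) B ↔ y + 1 ∈ Set.range (F' n) := by
    intro n y
    change (Phi (f' n) B y).Dom ↔ _
    rw [hPhi, hd, search_dom]
    simp
  refine ⟨g, hg, f', hf', fun n => ⟨fun y hy => ?_, ?_⟩⟩
  · obtain ⟨s, hs⟩ := mem_Phi_iff.1 (show y ∈ Phi n (jump ∅) n from hy)
    obtain ⟨s₀, hs₀⟩ := hf n
    obtain ⟨s₁, hs₁⟩ := hlim' n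
    have h1 := hs₀ (max s s₀) (le_max_right _ _)
    rw [hval hs _ (le_max_left _ _)] at h1
    exact (hW n y).2 ⟨s₁, by rw [hs₁ s₁ le_rfl, h1]⟩
  · obtain ⟨h1, h2⟩ := ncard_range_le (hchg n).1 (hchg n).2
    have hinj : Set.InjOn Nat.succ (W (f' n) B) := fun a _ b _ hab => Nat.succ_injective hab
    have hsub' : Nat.succ '' W (f' n) B ⊆ Set.range (F' n) := by
      rintro _ ⟨y, hy, rfl⟩
      exact (hW n y).1 hy
    refine ⟨Set.Finite.of_finite_image (h1.subset hsub') hinj, ?_⟩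
    rw [← hinj.ncard_image]
    exact (Set.ncard_le_ncard hsub' h1).trans h2

/-! ### The tree of jump traceable sets -/

/-- The first extension of the string `b` along which the `n`-th program halts at `n`. -/
noncomputable def haltExt (n : ℕ) (b : List Bool) : Part (List Bool) :=
  Nat.rfindOpt fun k => cond (strEval (b ++ (decode k).getD []) n n).isSome
    (some (b ++ (decode k).getD [])) none

theorem partrec_haltExt : Partrec₂ haltExt := by
  have hτ : Computable fun p : (ℕ × List Bool) × ℕ =>
      p.1.2 ++ (decode (α := List Bool) p.2).getD [] :=
    Computable.list_append.comp (Computable.snd.comp Computable.fst)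
      (Computable.option_getD (Computable.decode.comp Computable.snd) (Computable.const []))
  have hn : Computable fun p : (ℕ × List Bool) × ℕ => p.1.1 := Computable.fst.comp Computable.fst
  have hs := primrec_strEval.to_comp.comp (Computable.pair hτ (Computable.pair hn hn))
  have hc : Computable₂ fun (p : ℕ × List Bool) (k : ℕ) =>
      cond (strEval (p.2 ++ (decode k).getD []) p.1 p.1).isSome
        (some (p.2 ++ (decode k).getD [])) none :=
    Computable.cond (Primrec.option_isSome.to_comp.comp hs) (Computable.option_some.comp hτ)
      (Computable.const none)
  have := Partrec.rfindOpt hc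
  exact this

theorem haltExt_spec {n : ℕ} {b τ : List Bool} (h : τ ∈ haltExt n b) :
    b <+: τ ∧ ∃ v, v ∈ strEval τ n n := by
  obtain ⟨k, hk⟩ := Nat.rfindOpt_spec h
  cases hs : (strEval (b ++ (decode k).getD []) n n).isSome with
  | false => simp [hs] at hk
  | true =>
    simp only [hs, cond_true, Option.mem_def, Option.some.injEq] at hk
    subst hk
    exact ⟨List.prefix_append _ _, Option.isSome_iff_exists.1 hs⟩

theorem haltExt_dom {n v : ℕ} {b τ : List Bool} (hb : b <+: τ) (hv : v ∈ strEval τ n n) :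
    (haltExt n b).Dom := by
  obtain ⟨ρ, rfl⟩ := hb
  refine Nat.rfindOpt_dom.2 ⟨encode ρ, b ++ ρ, ?_⟩
  simp [Option.mem_def.1 hv]

/-- One step of the construction: the digit `d` consists of a guess `d / 2 % 2`, whether an
extension of `b` makes the `n`-th program halt at `n`, and of a bit `d % 2` to append. A wrong
positive guess makes the result undefined. -/
noncomputable def step (n d : ℕ) (b : List Bool) : Part (List Bool) :=
  (cond (decide (d / 2 % 2 = 1)) (haltExt n b) (Part.some b)).map fun τ => τ ++ [decide (d % 2 = 1)]

/-- The node of level `n` of the tree that is reached along the word `w`, whose base `4` digits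
are, from the most significant one of `n` digits, the digits used in the steps `0, 1, …, n - 1`. -/
noncomputable def node : ℕ → ℕ → Part (List Bool)
  | 0, _ => Part.some []
  | n + 1, w => (node n (w / 4)).bind (step n w)

theorem partrec_step : Partrec fun p : ℕ × ℕ × List Bool => step p.1 p.2.1 p.2.2 := by
  have hd : Primrec fun p : ℕ × ℕ × List Bool => p.2.1 := Primrec.fst.comp Primrec.snd
  have h2 : Primrec fun p : ℕ × ℕ × List Bool => decide (p.2.1 % 2 = 1) :=
    Primrec.eq.decide.comp (Primrec.nat_mod.comp hd (Primrec.const 2)) (Primrec.const 1)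
  have h1 : Primrec fun p : ℕ × ℕ × List Bool => decide (p.2.1 / 2 % 2 = 1) :=
    Primrec.eq.decide.comp (Primrec.nat_mod.comp (Primrec.nat_div.comp hd (Primrec.const 2))
      (Primrec.const 2)) (Primrec.const 1)
  refine Partrec.map (Partrec.cond h1.to_comp (partrec_haltExt.comp Computable.fst
    (Computable.snd.comp Computable.snd)) (Computable.snd.comp Computable.snd).partrec) ?_
  exact (Primrec.list_concat.comp Primrec.snd (h2.comp Primrec.fst)).to_comp

/-- The recursion defining `node` changes the word; with a fixed word it is a recursion to which
`Partrec.nat_rec` applies. -/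
theorem node_eq_rec (n w i : ℕ) (hi : i ≤ n) : node i (w / 4 ^ (n - i)) =
    Nat.rec (Part.some []) (fun j IH => IH.bind (step j (w / 4 ^ (n - (j + 1))))) i := by
  induction i with
  | zero => rfl
  | succ i ih =>
    change _ = Part.bind (Nat.rec (Part.some [])
      (fun j IH => IH.bind (step j (w / 4 ^ (n - (j + 1))))) i) _
    rw [← ih (Nat.le_of_succ_le hi), node, Nat.div_div_eq_div_mul, ← pow_succ,
      show n - (i + 1) + 1 = n - i by omega]

theorem primrec_four_pow : Primrec fun n : ℕ => 4 ^ n := by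
  refine (Primrec.nat_rec₁ 1 (Primrec.nat_mul.comp (Primrec.const 4) Primrec.snd).to₂).of_eq
    fun n => ?_
  induction n with
  | zero => rfl
  | succ n ih => simp only [ih]; ring

theorem partrec_node : Partrec₂ node := by
  have hpow : Primrec fun q : (ℕ × ℕ) × ℕ × List Bool => q.1.2 / 4 ^ (q.1.1 - (q.2.1 + 1)) :=
    Primrec.nat_div.comp (Primrec.snd.comp Primrec.fst) (primrec_four_pow.comp
      (Primrec.nat_sub.comp (Primrec.fst.comp Primrec.fst)
        (Primrec.succ.comp (Primrec.fst.comp Primrec.snd))))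
  have hstep : Partrec₂ fun (p : ℕ × ℕ) (q : ℕ × List Bool) =>
      step q.1 (p.2 / 4 ^ (p.1 - (q.1 + 1))) q.2 :=
    partrec_step.comp (Computable.pair (Computable.fst.comp Computable.snd)
      (Computable.pair hpow.to_comp (Computable.snd.comp Computable.snd)))
  refine (Partrec.nat_rec Computable.fst (Computable.const ([] : List Bool)).partrec hstep).of_eq
    fun p => ?_
  have := node_eq_rec p.1 p.2 p.1 le_rfl
  rw [Nat.sub_self, pow_zero, Nat.div_one] at this
  exact this.symm

/-! ### The path coding a given set -/

open Classical in
/-- The pair of the word with correct guesses and the bits of `A` as second components of its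
digits, and of the node reached along this word. -/
noncomputable def path (A : Set ℕ) : ℕ → ℕ × List Bool
  | 0 => (0, [])
  | n + 1 =>
    let a := decide (n ∈ A)
    if h : (haltExt n (path A n).2).Dom then
      (4 * (path A n).1 + (2 + a.toNat), (haltExt n (path A n).2).get h ++ [a])
    else (4 * (path A n).1 + a.toNat, (path A n).2 ++ [a])

theorem path_fst_lt (A : Set ℕ) (n : ℕ) : (path A n).1 < 4 ^ n := by
  classical
  induction n with
  | zero => simp [path]
  | succ n ih =>
    have := Bool.toNat_le (decide (n ∈ A))
    rw [path, pow_succ]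
    split_ifs <;> dsimp only <;> omega

theorem path_fst_mod_two (A : Set ℕ) (n : ℕ) : (path A (n + 1)).1 % 2 = 1 ↔ n ∈ A := by
  rw [path]
  split_ifs <;> by_cases h : n ∈ A <;> simp [h] <;> omega

theorem mem_node_path (A : Set ℕ) (n : ℕ) : (path A n).2 ∈ node n (path A n).1 := by
  classical
  induction n with
  | zero => simp [path, node]
  | succ n ih =>
    have ha := Bool.toNat_le (decide (n ∈ A))
    have key : ∀ k, k % 2 = 0 → decide ((4 * (path A n).1 + (k + (decide (n ∈ A)).toNat)) % 2 = 1) =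
        decide (n ∈ A) := by
      intro k hk
      by_cases h : n ∈ A <;> simp [h] <;> omega
    rw [path, node]
    split_ifs with h
    · refine Part.mem_bind (a := (path A n).2) ?_ ?_
      · dsimp only
        rwa [show (4 * (path A n).1 + (2 + (decide (n ∈ A)).toNat)) / 4 = (path A n).1 by omega]
      · have h1 : (4 * (path A n).1 + (2 + (decide (n ∈ A)).toNat)) / 2 % 2 = 1 := by omega
        simp only [step, h1, key 2 rfl, decide_true, cond_true]
        exact Part.mem_map _ (Part.get_mem h)
    · refine Part.mem_bind (a := (path A n).2) ?_ ?_
      · dsimp only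
        rwa [show (4 * (path A n).1 + (decide (n ∈ A)).toNat) / 4 = (path A n).1 by omega]
      · have h1 : ¬ (4 * (path A n).1 + (decide (n ∈ A)).toNat) / 2 % 2 = 1 := by omega
        have h2 := key 0 rfl
        rw [Nat.zero_add] at h2
        simp only [step, h1, h2, decide_false, cond_false]
        exact Part.mem_map _ (Part.mem_some _)

theorem path_snd_prefix_succ (A : Set ℕ) (n : ℕ) :
    (path A n).2 <+: (path A (n + 1)).2 ∧ (path A n).2.length < (path A (n + 1)).2.length := by
  rw [path]
  split_ifs with h
  · have := (haltExt_spec (Part.get_mem h)).1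
    exact ⟨this.trans (List.prefix_append _ _), by
      have := this.length_le
      simp only [List.length_append, List.length_singleton]
      omega⟩
  · exact ⟨List.prefix_append _ _, by simp⟩

theorem path_snd_prefix (A : Set ℕ) {m n : ℕ} (h : m ≤ n) : (path A m).2 <+: (path A n).2 := by
  induction n, h using Nat.le_induction with
  | base => exact List.prefix_rfl
  | succ n _ ih => exact ih.trans (path_snd_prefix_succ A n).1

theorem le_length_path (A : Set ℕ) (n : ℕ) : n ≤ (path A n).2.length := by
  induction n with
  | zero => exact Nat.zero_le _
  | succ n ih => exact ih.trans_lt (path_snd_prefix_succ A n).2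

/-- The union of the nodes on the path coding `A`. -/
def pathSet (A : Set ℕ) : Set ℕ := {m | (path A (m + 1)).2[m]? = some true}

theorem initSeg_pathSet (A : Set ℕ) (n : ℕ) :
    initSeg (pathSet A) (path A n).2.length = (path A n).2 := by
  classical
  refine List.ext_getElem (length_initSeg _ _) fun i h1 h2 => ?_
  have h3 : i < (path A (i + 1)).2.length := le_length_path A (i + 1)
  have h4 : (path A (i + 1)).2[i] = (path A n).2[i] := by
    rcases le_total (i + 1) n with h | h
    · exact (path_snd_prefix A h).getElem h3
    · exact ((path_snd_prefix A h).getElem h2).symm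
  simp only [initSeg, pathSet, List.getElem_map, List.getElem_range, Set.mem_ofPred_eq,
    List.getElem?_eq_getElem h3, Option.some.injEq, h4, Bool.decide_eq_true]

theorem initSeg_of_prefix {X : Set ℕ} {σ τ : List Bool} (h : σ <+: τ)
    (hτ : initSeg X τ.length = τ) : initSeg X σ.length = σ := by
  rw [← take_initSeg h.length_le, hτ]
  exact (List.prefix_iff_eq_take.1 h).symm

/-- Among the words whose node is an initial segment of `pathSet A`, the one with correct guesses
is the largest: at the first difference the other word has the same bit of `A` if it has the same
guess, so its guess is wrong, and it is not a wrong positive guess. -/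
theorem le_path_fst {A : Set ℕ} {n w : ℕ} {τ : List Bool} (hτ : τ ∈ node n w) (hw : w < 4 ^ n)
    (hp : initSeg (pathSet A) τ.length = τ) : w ≤ (path A n).1 := by
  classical
  induction n generalizing w τ with
  | zero => simp at hw; simp [hw]
  | succ n ih =>
    obtain ⟨b, hb, hs⟩ := Part.mem_bind_iff.1 hτ
    obtain ⟨t, ht, rfl⟩ := (Part.mem_map_iff _).1 hs
    have hbt : b <+: t := by
      cases hg : decide (w / 2 % 2 = 1) with
      | true => rw [hg, cond_true] at ht; exact (haltExt_spec ht).1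
      | false =>
        rw [hg, cond_false, Part.mem_some_iff] at ht
        exact ht ▸ List.prefix_rfl
    have hle := ih hb (by rw [pow_succ] at hw; omega)
      (initSeg_of_prefix (hbt.trans (List.prefix_append _ _)) hp)
    have ha := Bool.toNat_le (decide (n ∈ A))
    rcases hle.lt_or_eq with hlt | heq
    · rw [path]
      split_ifs <;> dsimp only <;> omega
    rw [heq] at hb
    obtain rfl := Part.mem_unique hb (mem_node_path A n)
    have hpath := initSeg_pathSet A (n + 1)
    -- with equal guesses both nodes extend the same string by one bit of the same set
    have key : ∀ {a : Bool}, initSeg (pathSet A) (t ++ [a]).length = t ++ [a] →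
        (w % 2 = 1 ↔ a = true) := by
      intro a h
      rw [List.length_append, List.length_singleton] at h hp
      rw [h] at hp
      have : a = decide (w % 2 = 1) := by simpa using hp
      simp [this]
    rw [path] at hpath ⊢
    by_cases hg : w / 2 % 2 = 1
    · simp only [hg, decide_true, cond_true] at ht
      have hd : (haltExt n (path A n).2).Dom := Part.dom_iff_mem.2 ⟨t, ht⟩
      simp only [hd, dif_pos] at hpath ⊢
      rw [Part.get_eq_of_mem ht] at hpath
      have := key hpath
      by_cases hA : n ∈ A <;> simp [hA] at this ⊢ <;> omega
    · simp only [hg, decide_false, cond_false, Part.mem_some_iff] at ht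
      split_ifs at hpath ⊢ with hd
      · dsimp only; omega
      · rw [← ht] at hpath
        have := key hpath
        by_cases hA : n ∈ A <;> simp [hA] at this ⊢ <;> omega

/-! ### Tracing the jump -/

/-- The value of the jump function at `e` along the extension chosen above the node of level `e`
reached along `w`. -/
noncomputable def traceValue (e w : ℕ) : Part ℕ :=
  (node e w).bind fun b => (haltExt e b).bind fun τ => (strEval τ e e : Part ℕ)

theorem partrec_traceValue : Partrec₂ traceValue := by
  refine Partrec.bind partrec_node (Partrec.bind (partrec_haltExt.comp
    (Computable.fst.comp Computable.fst) Computable.snd) ?_)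
  have he : Computable fun p : ((ℕ × ℕ) × List Bool) × List Bool => p.1.1.1 :=
    Computable.fst.comp (Computable.fst.comp Computable.fst)
  exact (primrec_strEval.to_comp.comp
    (Computable.pair Computable.snd (Computable.pair he he))).ofOption

theorem exists_mem_traceValue {A : Set ℕ} {n y : ℕ} (hy : y ∈ J (pathSet A) n) :
    ∃ w < 4 ^ n, y ∈ traceValue n w := by
  refine ⟨_, path_fst_lt A n, Part.mem_bind (mem_node_path A n) ?_⟩
  obtain ⟨k, hk⟩ := mem_Phi_iff.1 (show y ∈ Phi n (pathSet A) n from hy)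
  have hd : (haltExt n (path A n).2).Dom := by
    refine haltExt_dom (τ := initSeg (pathSet A) (max k (path A n).2.length)) ?_
      (strEval_mono (initSeg_prefix (le_max_left _ _)) hk)
    conv_lhs => rw [← initSeg_pathSet A n]
    exact initSeg_prefix (le_max_right _ _)
  have hp := initSeg_pathSet A (n + 1)
  rw [path, dif_pos hd] at hp
  have hp := initSeg_of_prefix (List.prefix_append _ _) hp
  refine Part.mem_bind (Part.get_mem hd) ?_
  obtain ⟨v, hv⟩ := (haltExt_spec (Part.get_mem hd)).2
  have hvJ : v ∈ J (pathSet A) n := mem_Phi_iff.2 ⟨_, by rwa [hp]⟩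
  rw [Part.mem_unique hy hvJ]
  exact Part.mem_coe.2 hv

theorem jumpTraceable_pathSet (A : Set ℕ) :
    JumpTraceableByWithBound (pathSet A) ∅ fun e => 4 ^ e := by
  classical
  obtain ⟨c, hc⟩ := Code.exists_code.1 (Partrec₂.unpaired'.2 partrec_traceValue)
  have hD : Computable₂ fun (a : ℕ) (_ : List Bool) =>
      decide (a.unpair.2.unpair.1 < 4 ^ a.unpair.1.unpair.1) &&
      decide (Code.evaln a.unpair.2.unpair.2 c (Nat.pair a.unpair.1.unpair.1 a.unpair.2.unpair.1) =
        some a.unpair.1.unpair.2) := by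
    have u : Primrec fun p : ℕ × List Bool => p.1.unpair := Primrec.unpair.comp Primrec.fst
    have u1 : Primrec fun p : ℕ × List Bool => p.1.unpair.1.unpair :=
      Primrec.unpair.comp (Primrec.fst.comp u)
    have u2 : Primrec fun p : ℕ × List Bool => p.1.unpair.2.unpair :=
      Primrec.unpair.comp (Primrec.snd.comp u)
    refine (Primrec.and.comp (Primrec.nat_lt.decide.comp (Primrec.fst.comp u2)
      (primrec_four_pow.comp (Primrec.fst.comp u1))) (Primrec.eq.decide.comp
        (Code.primrec_evaln.comp (Primrec.pair (Primrec.pair (Primrec.snd.comp u2)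
          (Primrec.const c)) (Primrec₂.natPair.comp (Primrec.fst.comp u1) (Primrec.fst.comp u2))))
        (Primrec.option_some.comp (Primrec.snd.comp u1)))).to_comp
  obtain ⟨d, hd⟩ := exists_search_code hD
  obtain ⟨f, hf, hPhi⟩ := exists_Phi_index d
  have hW : ∀ n y, y ∈ W (f n) ∅ ↔ ∃ w < 4 ^ n, y ∈ traceValue n w := by
    intro n y
    change (Phi (f n) ∅ y).Dom ↔ _
    rw [hPhi, hd, search_dom]
    simp only [Nat.unpair_pair, Bool.and_eq_true, decide_eq_true_eq]
    have hcw : ∀ w, c.eval (Nat.pair n w) = traceValue n w := fun w => by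
      rw [hc, Nat.unpaired, Nat.unpair_pair]
    constructor
    · rintro ⟨k, hk, hv⟩
      exact ⟨_, hk, hcw _ ▸ Code.evaln_sound hv⟩
    · rintro ⟨w, hw, hv⟩
      obtain ⟨s, hs⟩ := Code.evaln_complete.1 (hcw w ▸ hv)
      exact ⟨Nat.pair w s, by simpa using hw, by simpa using hs⟩
  refine ⟨f, hf, fun n => ⟨fun y hy => (hW n y).2 (exists_mem_traceValue hy), ?_⟩⟩
  have hsub : W (f n) ∅ ⊆ ((Finset.range (4 ^ n)).image fun w =>
      if h : (traceValue n w).Dom then (traceValue n w).get h else 0 : Finset ℕ) := by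
    intro y hy
    obtain ⟨w, hw, hv⟩ := (hW n y).1 hy
    refine Finset.mem_coe.2 (Finset.mem_image.2 ⟨w, Finset.mem_range.2 hw, ?_⟩)
    rw [dif_pos (Part.dom_iff_mem.2 ⟨y, hv⟩)]
    exact Part.get_eq_of_mem hv _
  refine ⟨(Finset.finite_toSet _).subset hsub, ?_⟩
  refine (Set.ncard_le_ncard hsub (Finset.finite_toSet _)).trans ?_
  rw [Set.ncard_coe_finset]
  exact Finset.card_image_le.trans (Finset.card_range _).le

/-! ### Decoding from the jump -/

theorem idxOf_true_eq {N m : ℕ} (hm : m < N) {p : ℕ → Bool} (hp : p m = true)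
    (hmax : ∀ w < N, p w = true → w ≤ m) :
    ((List.range N).map fun k => p (N - 1 - k)).idxOf true = N - 1 - m := by
  have hlt : N - 1 - m < ((List.range N).map fun k => p (N - 1 - k)).length := by
    simp; omega
  rw [List.idxOf, List.findIdx_eq hlt]
  refine ⟨?_, fun j hj => ?_⟩
  · simp [show N - 1 - (N - 1 - m) = m by omega, hp]
  · by_contra hcon
    have := hmax (N - 1 - j) (by omega) (by simpa using hcon)
    omega

/-- Whether a partial computable string is defined and an initial segment of `X` is decided by the
jump of `X`, uniformly. -/
theorem exists_jump_index_initSeg {φ : ℕ →. List Bool} (hφ : Partrec φ) :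
    ∃ h : ℕ → ℕ, Computable h ∧
      ∀ X a, h a ∈ jump X ↔ ∃ τ ∈ φ a, initSeg X τ.length = τ := by
  have hφ' : Partrec fun a : ℕ => (φ a).map encode :=
    Partrec.map hφ (Computable.encode.comp Computable.snd).to₂
  obtain ⟨c, hc⟩ := Code.exists_code.1 (Partrec.nat_iff.1 hφ')
  have hD : Computable₂ fun (a : ℕ) (σ : List Bool) =>
      (((Code.evaln a.unpair.2 c a.unpair.1).bind (decode (α := List Bool))).map
        fun τ => decide (σ.take τ.length = τ)).getD false := by
    have u : Primrec fun p : ℕ × List Bool => p.1.unpair := Primrec.unpair.comp Primrec.fst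
    have hev : Primrec fun p : ℕ × List Bool => Code.evaln p.1.unpair.2 c p.1.unpair.1 :=
      Code.primrec_evaln.comp (Primrec.pair (Primrec.pair (Primrec.snd.comp u)
        (Primrec.const c)) (Primrec.fst.comp u))
    have hdec : Primrec fun p : ℕ × List Bool =>
        (Code.evaln p.1.unpair.2 c p.1.unpair.1).bind (decode (α := List Bool)) :=
      Primrec.option_bind hev (Primrec.decode.comp Primrec.snd).to₂
    have htake : Primrec₂ fun (p : ℕ × List Bool) (τ : List Bool) =>
        decide (p.2.take τ.length = τ) :=
      Primrec.eq.decide.comp (Primrec.list_take.comp (Primrec.list_length.comp Primrec.snd)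
        (Primrec.snd.comp Primrec.fst)) Primrec.snd
    exact (Primrec.option_getD.comp (Primrec.option_map hdec htake) (Primrec.const false)).to_comp
  obtain ⟨d, hd⟩ := exists_search_code hD
  obtain ⟨h, hh, hJ⟩ := exists_J_index d
  refine ⟨h, hh, fun X a => ?_⟩
  change (J X (h a)).Dom ↔ _
  rw [hJ, hd, search_dom]
  simp only [Nat.unpair_pair]
  constructor
  · rintro ⟨k, hk⟩
    cases hm : Code.evaln k c a with
    | none => simp [hm] at hk
    | some m =>
      have hmem := Code.evaln_sound hm
      rw [hc] at hmem
      obtain ⟨τ, hτ, rfl⟩ := (Part.mem_map_iff _).1 hmem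
      simp only [hm, Option.bind_some, encodek, Option.map_some, Option.getD_some,
        decide_eq_true_eq] at hk
      have hlen := congrArg List.length hk
      rw [List.length_take, length_initSeg] at hlen
      rw [take_initSeg (by omega)] at hk
      exact ⟨τ, hτ, hk⟩
  · rintro ⟨τ, hτ, hp⟩
    have hmem : encode τ ∈ c.eval a := by
      rw [hc]
      exact Part.mem_map _ hτ
    obtain ⟨s, hs⟩ := Code.evaln_complete.1 hmem
    refine ⟨max s τ.length, ?_⟩
    rw [Option.mem_def.1 (Code.evaln_mono (le_max_left s τ.length) hs), Option.bind_some, encodek,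
      Option.map_some, Option.getD_some, take_initSeg (le_max_right _ _), hp, decide_eq_true rfl]

theorem computable_map_range {N : ℕ → ℕ} {F : ℕ → ℕ → ℕ} (hN : Computable N) (hF : Computable₂ F) :
    Computable fun n => (List.range (N n)).map (F n) := by
  have hstep : Computable₂ fun (n : ℕ) (p : ℕ × List ℕ) => p.2 ++ [F n p.1] :=
    Computable.list_concat.comp (Computable.snd.comp Computable.snd)
      (hF.comp Computable.fst (Computable.fst.comp Computable.snd))
  refine (Computable.nat_rec hN (Computable.const []) hstep).of_eq fun n => ?_
  induction N n with
  | zero => rfl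
  | succ k ih => simp only [ih, List.range_succ, List.map_append, List.map_singleton]

/-- The table looks for the last accepted word of length `n + 1`; its last digit carries the bit
`n` of `A`. -/
theorem ttReducible_jump_pathSet (A : Set ℕ) : TTReducible A (jump (pathSet A)) := by
  classical
  obtain ⟨h, hh, hjump⟩ := exists_jump_index_initSeg
    (φ := fun a => node a.unpair.1 a.unpair.2)
    (partrec_node.comp (Computable.fst.comp Computable.unpair)
      (Computable.snd.comp Computable.unpair))
  -- the words are listed in decreasing order, so the largest accepted one comes first
  let q : ℕ → List ℕ := fun n =>
    (List.range (4 ^ (n + 1))).map fun k => h (Nat.pair (n + 1) (4 ^ (n + 1) - 1 - k))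
  refine ⟨q, fun _ l => decide (l.idxOf true % 2 = 0), ?_, ?_, fun n => ?_⟩
  · have hpow : Computable fun n : ℕ => 4 ^ (n + 1) :=
      (primrec_four_pow.comp Primrec.succ).to_comp
    refine computable_map_range hpow (hh.comp (Primrec₂.natPair.to_comp.comp
      (Computable.succ.comp Computable.fst) ?_))
    exact Primrec.nat_sub.to_comp.comp (Primrec.nat_sub.to_comp.comp (hpow.comp Computable.fst)
      (Computable.const 1)) Computable.snd
  · exact (Primrec.eq.decide.comp (Primrec.nat_mod.comp (Primrec.list_idxOf.comp
      (Primrec.const true) Primrec.snd) (Primrec.const 2)) (Primrec.const 0)).to_comp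
  · have hp : ∀ w, decide (h (Nat.pair (n + 1) w) ∈ jump (pathSet A)) = true ↔
        ∃ τ ∈ node (n + 1) w, initSeg (pathSet A) τ.length = τ := fun w => by
      rw [decide_eq_true_eq, hjump]
      simp
    have hlt := path_fst_lt A (n + 1)
    have hidx := idxOf_true_eq (p := fun w => decide (h (Nat.pair (n + 1) w) ∈ jump (pathSet A)))
      hlt ((hp _).2 ⟨_, mem_node_path A (n + 1), initSeg_pathSet A (n + 1)⟩)
      fun w hw hpw => by
        obtain ⟨τ, hτ, hpre⟩ := (hp w).1 hpw
        exact le_path_fst hτ hw hpre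
    have hq : (q n).map (fun m => decide (m ∈ jump (pathSet A))) =
        (List.range (4 ^ (n + 1))).map fun k =>
          decide (h (Nat.pair (n + 1) (4 ^ (n + 1) - 1 - k)) ∈ jump (pathSet A)) := by
      simp [q, Function.comp_def]
    have h4 : 4 ^ (n + 1) = 4 * 4 ^ n := by ring
    dsimp only
    rw [hq, hidx, decide_eq_true_eq, ← path_fst_mod_two A n]
    omega

end Superhighness

theorem theorem2p1 :
    (∃ B : Set ℕ, Superhighness.Superhigh B ∧ Superhighness.JumpTraceable B ∧
      Superhighness.JumpTraceableByWithBound B ∅ (fun e => 4 ^ e) ∧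
      ¬ Superhighness.JTHard B ∧ ¬ Superhighness.BLRHard B) ∧
    (∀ A : Set ℕ, ∃ B : Set ℕ, Superhighness.TTReducible A (Superhighness.jump B) ∧
      Superhighness.JumpTraceableByWithBound B ∅ (fun e => 4 ^ e)) := by
  have h := fun A => And.intro (Superhighness.ttReducible_jump_pathSet A)
    (Superhighness.jumpTraceable_pathSet A)
  refine ⟨?_, fun A => ⟨_, h A⟩⟩
  obtain ⟨hsuper, htrace⟩ := h (Superhighness.jump (Superhighness.jump ∅))
  have hJT : Superhighness.JumpTraceable _ := ⟨_, Superhighness.primrec_four_pow.to_comp, htrace⟩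
  have hnot := Superhighness.not_JTHard_of_jumpTraceable hJT
  exact ⟨_, hsuper, hJT, htrace, hnot, fun hB => hnot (Superhighness.JTHard_of_BLRHard hB)⟩
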